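/- Fix $K$ arms, $\sigma,\sigma'>0$, and for each arm $k$ real numbers $\mu_k,\mu'_k,L_k$ with $|\mu_k-\mu'_k|\le L_k$. Pulling arm $k$ yields independent rewards of law $\mathcal N(\mu_k,\sigma^2)$; before the first round the learner receives, independently of all rewards and independently across arms, $N'_k\in\{0,1,2,\dots\}\cup\{+\infty\}$ i.i.d. source samples of law $\mathcal N(\mu'_k,\sigma'^2)$ for each arm $k$, with empirical mean $\hat\mu'_k$ (for $N'_k=\infty$, the limit of the finite empirical means). Let arm $1$ have the highest mean $\mu_1=\max_k\mu_k$, and write $x_+=\max\{x,0\}$ and $\infty\cdot 0=0$. The policy KL-UCB-Transfer pulls, in each round $t=1,2,\dots$, an arm $a$ of maximal index (ties broken arbitrarily) $$U_a(t)=\sup\Bigl\{q\in\mathbb R:\ N_a(t-1)\frac{(q-\hat\mu_a(t-1))_+^2}{2\sigma^2}+N'_a\frac{(q-\hat\mu'_a-L_a)_+^2}{2\sigma'^2}\le\delta_t\Bigr\},\qquad \delta_t=\ln t+3\ln(\max\{1,\ln t\}),$$ where $N_a(t)$ is the number of pulls of arm $a$ in rounds $1,\dots,t$ and $\hat\mu_a(t)$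 is the empirical mean of the rewards received from them (so $U_a(t)=+\infty$ if $N_a(t-1)=N'_a=0$). Then for every suboptimal arm $a$ (i.e. $\mu_a<\mu_1$) there is a constant $C$, depending only on $a$, $\sigma$, $\sigma'$, $(\mu_k)_k$, $(\mu'_k)_k$, $(L_k)_k$, and in particular not on the sample sizes $(N'_k)_k$ (which may therefore depend on $T$), such that for all $T\ge 2$ $$\mathbb E[N_a(T)]\ \le\ \frac{2\sigma^2}{(\mu_1-\mu_a)^2}\Bigl(\ln T-N'_a\,\frac{(\mu_1-\mu'_a-L_a)_+^2}{2\sigma'^2}\Bigr)_+ + C\,(\ln T)^{2/3}.$$ -/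

import Mathlib

open MeasureTheory ProbabilityTheory Filter Topology
open scoped ENNReal

universe u

noncomputable section

namespace KLUCBTransfer

/-- Number of pulls of arm `a` in rounds `1, …, t`, for the sequence of actions `A`
(rounds are numbered from `1`; the value `A 0` is never used). -/
def pulls {K : ℕ} (A : ℕ → Fin K) (a : Fin K) (t : ℕ) : ℕ :=
  ((Finset.Icc 1 t).filter (fun s => A s = a)).card

/-- Reward observed in round `t`. Each arm `k` carries a stack `x k 0, x k 1, …` of rewards, and
its `(i+1)`-st pull yields `x k i`. -/
def reward {K : ℕ} (x : Fin K → ℕ → ℝ) (A : ℕ → Fin K) (t : ℕ) : ℝ :=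
  x (A t) (pulls A (A t) (t - 1))

/-- Empirical mean of the rewards observed from arm `a` in rounds `1, …, t`
(the value is immaterial if there are none). -/
def empiricalMean {K : ℕ} (x : Fin K → ℕ → ℝ) (A : ℕ → Fin K) (a : Fin K) (t : ℕ) : ℝ :=
  (∑ s ∈ (Finset.Icc 1 t).filter (fun s => A s = a), reward x A s) / (pulls A a t : ℝ)

/-- Mean of the first `n` source samples. -/
def sampleMean (y : ℕ → ℝ) (n : ℕ) : ℝ :=
  (∑ i ∈ Finset.range n, y i) / (n : ℝ)

/-- Empirical mean of `n` source samples; for `n = ∞` it is the limit of the finite means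
(which exists almost surely for i.i.d. integrable samples). -/
def sourceMean (y : ℕ → ℝ) : ℕ∞ → ℝ
  | some n => sampleMean y n
  | none => limUnder atTop (sampleMean y)

/-- `n' (q - c)₊² / (2 σ'²)` as an extended nonnegative number, with `∞ * 0 = 0`. -/
def sourcePenalty (σ' : ℝ) (n' : ℕ∞) (c q : ℝ) : ℝ≥0∞ :=
  (n' : ℝ≥0∞) * ENNReal.ofReal ((max (q - c) 0) ^ 2 / (2 * σ' ^ 2))

/-- Exploration level `δ_t = ln t + 3 ln (max (1, ln t))`. -/
def explorationLevel (t : ℕ) : ℝ :=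
  Real.log t + 3 * Real.log (max 1 (Real.log t))

/-- The index of arm `a` used to choose the action of round `t`: the largest `q` such that
`N_a (q - μ̂_a)₊² / (2 σ²) + N'_a (q - μ̂'_a - L_a)₊² / (2 σ'²) ≤ δ_t`, where `N_a`, `μ̂_a` are the
number of pulls and the empirical mean of arm `a` before round `t`. It is a supremum in the
extended reals, equal to `∞` if there is neither a source sample nor an earlier pull. -/
def index {K : ℕ} (σ σ' : ℝ) (L : Fin K → ℝ) (N' : Fin K → ℕ∞)
    (x y : Fin K → ℕ → ℝ) (A : ℕ → Fin K) (a : Fin K) (t : ℕ) : EReal :=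
  sSup ((fun q : ℝ => (q : EReal)) '' {q : ℝ |
    ENNReal.ofReal ((pulls A a (t - 1) : ℝ) *
        (max (q - empiricalMean x A a (t - 1)) 0) ^ 2 / (2 * σ ^ 2))
      + sourcePenalty σ' (N' a) (sourceMean (y a) (N' a) + L a) q
      ≤ ENNReal.ofReal (explorationLevel t)})

/-- The data of the transfer bandit problem: the target rewards `X k i ∼ 𝒩(μ k, σ²)` and the source
samples `Y k i ∼ 𝒩(μ' k, σ'²)` are all independent. -/
structure IsGaussianTransferModel {K : ℕ} {Ω : Type u} [MeasurableSpace Ω] (P : Measure Ω)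
    (μ μ' : Fin K → ℝ) (σ σ' : ℝ) (X Y : Fin K → ℕ → Ω → ℝ) : Prop where
  measurable_target : ∀ k i, Measurable (X k i)
  measurable_source : ∀ k i, Measurable (Y k i)
  law_target : ∀ k i, P.map (X k i) = gaussianReal (μ k) (Real.toNNReal (σ ^ 2))
  law_source : ∀ k i, P.map (Y k i) = gaussianReal (μ' k) (Real.toNNReal (σ' ^ 2))
  indep : iIndepFun
    (Sum.elim (fun p : Fin K × ℕ => X p.1 p.2) (fun p : Fin K × ℕ => Y p.1 p.2)) P

/-- `A` is a run of the policy: in every round `t ≥ 1` it pulls an arm of maximal index, with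
an arbitrary (measurable) way of breaking ties. -/
structure IsPolicyRun {K : ℕ} {Ω : Type u} [MeasurableSpace Ω] (σ σ' : ℝ) (L : Fin K → ℝ)
    (N' : Fin K → ℕ∞) (X Y : Fin K → ℕ → Ω → ℝ) (A : ℕ → Ω → Fin K) : Prop where
  measurable_action : ∀ t, Measurable (A t)
  maximal : ∀ ω, ∀ t, 1 ≤ t → ∀ k,
    index σ σ' L N' (fun j i => X j i ω) (fun j i => Y j i ω) (fun s => A s ω) k t ≤
      index σ σ' L N' (fun j i => X j i ω) (fun j i => Y j i ω) (fun s => A s ω) (A t ω) t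

/-- `(ln T - n' (m - c)₊² / (2 σ'²))₊`; subtraction in `ℝ≥0∞` is truncated at `0`, which is the
outer positive part, also when `n' = ∞`. -/
def logResidual (σ' : ℝ) (n' : ℕ∞) (c m : ℝ) (T : ℕ) : ℝ :=
  (ENNReal.ofReal (Real.log T) - sourcePenalty σ' n' c m).toReal

end KLUCBTransfer

end

namespace KLUCBTransfer

/-! ### Pull counts and empirical means -/

/-! Write `l = ln T`, `Δ = μ best - μ a`, and fix a resolution `ε`. A pull of `a` requires either
that the index of the best arm lies below `μ best - ε`, or that the index of `a` exceeds `μ best -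
2ε`. The first event is rare by concentration; the second restricts the number of earlier pulls of
`a`.

For the best arm, `|μ - μ'| ≤ L` makes its penalty at `μ best - ε` at most the sum of the normalized
squared deviations of its two empirical means. These are independent squared Gaussians, so `exp (s ·
sum)` has mean at most `(1 - s)⁻¹`, whatever the sample sizes (`lintegral_exp_mul_deviation_le`).
Evaluating `ε` below the mean gains an extra `n ε² / (2σ²)` in the exponent. The union bound over
the random number `n` of pulls is then a geometric series costing `O(1/ε²)`, and no peeling is
needed. With `x = δ_t` the remaining factor `x e^(1-x)` is `O(1 / (t ln² t))`, which is summable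
(`real_deviationEvent_le`).

For arm `a`, unless its empirical mean exceeds `μ a + ε` (`O(1/ε²)` expected sample sizes), `n (Δ -
3ε)² / (2σ²)` is at most the budget `δ_T` minus the source penalty (`card_penalty_le`). Replacing
the source mean by `μ' a` changes this residual by `O(ε l)` plus a term of expectation `O(1/ε²)`,
uniformly in `N'` (`toReal_sub_sourcePenalty_le`, `mul_real_sourceExceeds_le`).

All errors are thus `O(ε l + 1/ε²)`, up to `ln l`, and `ε = l^(-1/3)` balances them at `l^(2/3)`. -/

theorem pulls_succ {K : ℕ} (A : ℕ → Fin K) (a : Fin K) (t : ℕ) :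
    pulls A a (t + 1) = pulls A a t + if A (t + 1) = a then 1 else 0 := by
  unfold pulls
  rw [Finset.card_filter, Finset.card_filter, Finset.sum_Icc_succ_top (by omega)]

theorem pulls_zero {K : ℕ} (A : ℕ → Fin K) (a : Fin K) : pulls A a 0 = 0 := by
  simp [pulls]

theorem pulls_mono {K : ℕ} (A : ℕ → Fin K) (a : Fin K) : Monotone (pulls A a) :=
  monotone_nat_of_le_succ fun t => by rw [pulls_succ]; omega

theorem pulls_le {K : ℕ} (A : ℕ → Fin K) (a : Fin K) (t : ℕ) : pulls A a t ≤ t := by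
  unfold pulls
  exact (Finset.card_filter_le _ _).trans (by simp)

theorem pulls_pred_lt {K : ℕ} (A : ℕ → Fin K) {t t' : ℕ} (ht : 1 ≤ t) (h : t < t') :
    pulls A (A t) (t - 1) < pulls A (A t) (t' - 1) := by
  obtain ⟨s, rfl⟩ : ∃ s, t = s + 1 := ⟨t - 1, by omega⟩
  have h1 := pulls_mono A (A (s + 1)) (show s + 1 ≤ t' - 1 by omega)
  rw [pulls_succ, if_pos rfl] at h1
  simpa using h1

/-- This removes the adaptivity: the rewards seen from an arm are an initial segment of its stack,
so a union bound over deterministic sample sizes suffices. -/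
theorem sum_reward {K : ℕ} (x : Fin K → ℕ → ℝ) (A : ℕ → Fin K) (a : Fin K) (t : ℕ) :
    ∑ s ∈ (Finset.Icc 1 t).filter (fun s => A s = a), reward x A s
      = ∑ i ∈ Finset.range (pulls A a t), x a i := by
  induction t with
  | zero => simp [pulls_zero]
  | succ t ih =>
    rw [Finset.sum_filter] at ih ⊢
    rw [Finset.sum_Icc_succ_top (by omega), ih, pulls_succ]
    split_ifs with h
    · rw [Finset.sum_range_succ, reward, h, Nat.add_sub_cancel]
    · simp

theorem empiricalMean_eq_sampleMean {K : ℕ} (x : Fin K → ℕ → ℝ) (A : ℕ → Fin K) (a : Fin K)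
    (t : ℕ) : empiricalMean x A a t = sampleMean (x a) (pulls A a t) := by
  rw [empiricalMean, sum_reward, sampleMean]

/-! ### The index as a confidence bound -/

/-- The penalty whose sublevel set defines the index: `n` rewards of mean `s`, and `n'` source
samples of shifted mean `c`. -/
noncomputable def penalty (σ σ' : ℝ) (n : ℕ) (n' : ℕ∞) (s c q : ℝ) : ℝ≥0∞ :=
  ENNReal.ofReal ((n : ℝ) * (max (q - s) 0) ^ 2 / (2 * σ ^ 2)) + sourcePenalty σ' n' c q

theorem sourcePenalty_mono (σ' : ℝ) (n' : ℕ∞) (c : ℝ) : Monotone (sourcePenalty σ' n' c) := by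
  intro q r h
  unfold sourcePenalty
  gcongr

theorem penalty_mono (σ σ' : ℝ) (n : ℕ) (n' : ℕ∞) (s c : ℝ) :
    Monotone (penalty σ σ' n n' s c) := by
  intro q r h
  unfold penalty
  exact add_le_add (by gcongr) (sourcePenalty_mono _ _ _ h)

theorem index_eq {K : ℕ} (σ σ' : ℝ) (L : Fin K → ℝ) (N' : Fin K → ℕ∞)
    (x y : Fin K → ℕ → ℝ) (A : ℕ → Fin K) (a : Fin K) (t : ℕ) :
    index σ σ' L N' x y A a t = sSup ((fun q : ℝ => (q : EReal)) '' {q : ℝ |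
      penalty σ σ' (pulls A a (t - 1)) (N' a) (sampleMean (x a) (pulls A a (t - 1)))
        (sourceMean (y a) (N' a) + L a) q ≤ ENNReal.ofReal (explorationLevel t)}) := by
  rw [index, empiricalMean_eq_sampleMean]
  rfl

theorem lt_penalty_of_index_lt {K : ℕ} {σ σ' : ℝ} {L : Fin K → ℝ} {N' : Fin K → ℕ∞}
    {x y : Fin K → ℕ → ℝ} {A : ℕ → Fin K} {a : Fin K} {t : ℕ} {q : ℝ}
    (h : index σ σ' L N' x y A a t < q) :
    ENNReal.ofReal (explorationLevel t) <
      penalty σ σ' (pulls A a (t - 1)) (N' a) (sampleMean (x a) (pulls A a (t - 1)))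
        (sourceMean (y a) (N' a) + L a) q := by
  by_contra! hc
  rw [index_eq] at h
  exact not_le.mpr h (le_sSup (Set.mem_image_of_mem (fun q : ℝ => (q : EReal)) hc))

theorem penalty_le_of_lt_index {K : ℕ} {σ σ' : ℝ} {L : Fin K → ℝ} {N' : Fin K → ℕ∞}
    {x y : Fin K → ℕ → ℝ} {A : ℕ → Fin K} {a : Fin K} {t : ℕ} {q : ℝ}
    (h : q < index σ σ' L N' x y A a t) :
    penalty σ σ' (pulls A a (t - 1)) (N' a) (sampleMean (x a) (pulls A a (t - 1)))
        (sourceMean (y a) (N' a) + L a) q ≤ ENNReal.ofReal (explorationLevel t) := by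
  rw [index_eq, lt_sSup_iff] at h
  obtain ⟨_, ⟨r, hr, rfl⟩, hqr⟩ := h
  exact (penalty_mono _ _ _ _ _ _ (EReal.coe_lt_coe_iff.mp hqr).le).trans hr

theorem explorationLevel_mono {s t : ℕ} (hs : 1 ≤ s) (h : s ≤ t) :
    explorationLevel s ≤ explorationLevel t := by
  unfold explorationLevel
  have h1 : Real.log s ≤ Real.log t := Real.log_le_log (by positivity) (by exact_mod_cast h)
  gcongr

/-- Every pull of `a` is either charged to a round in which the index of the arm `b` is below `q`,
or to a sample size for which the penalty of `a` at `r < q` is below the exploration level. -/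
theorem pulls_le_add {K : ℕ} {σ σ' : ℝ} {L : Fin K → ℝ} {N' : Fin K → ℕ∞}
    {x y : Fin K → ℕ → ℝ} {A : ℕ → Fin K}
    (hA : ∀ t, 1 ≤ t → ∀ k, index σ σ' L N' x y A k t ≤ index σ σ' L N' x y A (A t) t)
    (a b : Fin K) {q r : ℝ} (hrq : r < q) (T : ℕ) :
    pulls A a T ≤ {t ∈ Finset.Icc 1 T | index σ σ' L N' x y A b t < q}.card
      + {n ∈ Finset.range T | penalty σ σ' n (N' a) (sampleMean (x a) n)
          (sourceMean (y a) (N' a) + L a) r ≤ ENNReal.ofReal (explorationLevel T)}.card := by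
  classical
  set U := {t ∈ Finset.Icc 1 T | A t = a ∧ ¬ index σ σ' L N' x y A b t < q} with hU
  have h1 : pulls A a T ≤ {t ∈ Finset.Icc 1 T | index σ σ' L N' x y A b t < q}.card + U.card := by
    unfold pulls
    refine le_trans (Finset.card_le_card ?_) (Finset.card_union_le _ _)
    intro t
    simp only [hU, Finset.mem_filter, Finset.mem_union]
    tauto
  refine h1.trans (Nat.add_le_add_left ?_ _)
  -- Distinct rounds pulling `a` see distinct numbers of earlier pulls, so these rounds can be
  -- counted by sample size.
  refine Finset.card_le_card_of_injOn (fun t => pulls A a (t - 1)) ?_ ?_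
  · intro t ht
    simp only [hU, Finset.coe_filter, Finset.mem_Icc, Set.mem_ofPred_eq, not_lt] at ht
    obtain ⟨⟨ht1, htT⟩, rfl, hq⟩ := ht
    simp only [Finset.coe_filter, Finset.mem_range, Set.mem_ofPred_eq]
    refine ⟨by have := pulls_le A (A t) (t - 1); omega, ?_⟩
    -- The gap `r < q` makes the inequality strict, so some point of the sublevel set lies above `r`
    -- even if the supremum is not attained.
    have h2 : (r : EReal) < index σ σ' L N' x y A (A t) t :=
      (EReal.coe_lt_coe_iff.mpr hrq).trans_le (hq.trans (hA t ht1 b))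
    exact (penalty_le_of_lt_index h2).trans
      (ENNReal.ofReal_le_ofReal (explorationLevel_mono ht1 htT))
  · intro t ht t' ht' htt
    simp only [hU, Finset.coe_filter, Finset.mem_Icc, Set.mem_ofPred_eq] at ht ht'
    obtain ⟨⟨ht1, -⟩, rfl, -⟩ := ht
    obtain ⟨⟨ht1', -⟩, h3, -⟩ := ht'
    rcases lt_trichotomy t t' with h | h | h
    · exact absurd htt (pulls_pred_lt A ht1 h).ne
    · exact h
    · have := pulls_pred_lt A ht1' h
      rw [h3] at this
      exact absurd htt this.ne'

/-! ### Exponential moments of Gaussian sample means -/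

section Gaussian

variable {Ω : Type*} [MeasurableSpace Ω] {P : Measure Ω}

open scoped NNReal in
theorem lintegral_exp_mul_sq_of_gaussian {X : Ω → ℝ} (hX : Measurable X) {m : ℝ} {v : ℝ≥0}
    (hv : v ≠ 0) (hlaw : P.map X = gaussianReal m v) {s : ℝ} (hs : s < 1) :
    ∫⁻ ω, ENNReal.ofReal (Real.exp (s * ((X ω - m) ^ 2 / (2 * v)))) ∂P
      = ENNReal.ofReal (√(1 - s))⁻¹ := by
  have hv' : (0 : ℝ) < v := by positivity
  have hs' : 0 < 1 - s := by linarith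
  have hb : 0 < (1 - s) / (2 * v) := by positivity
  have hmeas : Measurable fun x : ℝ => ENNReal.ofReal (Real.exp (s * ((x - m) ^ 2 / (2 * v)))) := by
    fun_prop
  rw [← lintegral_map (μ := P) (g := X) hmeas hX, hlaw, gaussianReal_of_var_ne_zero m hv,
    lintegral_withDensity_eq_lintegral_mul _ (measurable_gaussianPDF m v) hmeas]
  have h1 : ∀ x : ℝ, (gaussianPDF m v *
        fun x : ℝ => ENNReal.ofReal (Real.exp (s * ((x - m) ^ 2 / (2 * v))))) x
      = ENNReal.ofReal ((√(2 * Real.pi * v))⁻¹ *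
        Real.exp (-((1 - s) / (2 * v)) * (x - m) ^ 2)) := by
    intro x
    rw [Pi.mul_apply, gaussianPDF, ← ENNReal.ofReal_mul (gaussianPDFReal_nonneg _ _ _),
      gaussianPDFReal, mul_assoc, ← Real.exp_add]
    congr 3
    field_simp
    ring
  simp_rw [h1]
  have hint : Integrable fun x : ℝ => Real.exp (-((1 - s) / (2 * v)) * (x - m) ^ 2) :=
    (integrable_exp_neg_mul_sq hb).comp_sub_right m
  rw [← ofReal_integral_eq_lintegral_ofReal (hint.const_mul _) (ae_of_all _ fun x => by positivity),
    integral_const_mul,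
    integral_sub_right_eq_self (fun x : ℝ => Real.exp (-((1 - s) / (2 * v)) * x ^ 2)),
    integral_gaussian]
  congr 1
  rw [show Real.pi / ((1 - s) / (2 * v)) = (2 * Real.pi * v) / (1 - s) by field_simp,
    Real.sqrt_div (by positivity)]
  have : √(2 * Real.pi * v) ≠ 0 := by positivity
  field_simp

open scoped NNReal in
theorem map_sum_of_gaussian [IsProbabilityMeasure P] {Z : ℕ → Ω → ℝ} (hZ : ∀ i, Measurable (Z i))
    (hind : iIndepFun Z P) {m : ℝ} {v : ℝ≥0} (hlaw : ∀ i, P.map (Z i) = gaussianReal m v) (n : ℕ) :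
    P.map (fun ω => ∑ i ∈ Finset.range n, Z i ω) = gaussianReal (n * m) (n * v) := by
  induction n with
  | zero => simp [Measure.map_const]
  | succ n ih =>
    have hI : IndepFun (∑ i ∈ Finset.range n, Z i) (Z n) P :=
      hind.indepFun_finsetSum_of_notMem hZ (by simp)
    have hsum : (∑ i ∈ Finset.range n, Z i) = fun ω => ∑ i ∈ Finset.range n, Z i ω := by
      ext ω; simp
    have := gaussianReal_add_gaussianReal_of_indepFun hI (by rw [hsum]; exact ih) (hlaw n)
    convert this using 1
    · congr 1; ext ω; simp [Finset.sum_range_succ]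
    · congr 1
      · push_cast; ring
      · push_cast; ring

theorem measurable_sampleMean {Z : ℕ → Ω → ℝ} (hZ : ∀ i, Measurable (Z i)) (n : ℕ) :
    Measurable fun ω => sampleMean (fun i => Z i ω) n := by
  unfold sampleMean
  fun_prop

/-- The normalized squared deviation is half the square of a standard Gaussian for every `n ≥ 1`,
and is zero for `n = 0`; hence a bound free of `n`. -/
theorem lintegral_exp_mul_sampleMean_le [IsProbabilityMeasure P] {Z : ℕ → Ω → ℝ}
    (hZ : ∀ i, Measurable (Z i)) (hind : iIndepFun Z P) {m σ : ℝ} (hσ : 0 < σ)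
    (hlaw : ∀ i, P.map (Z i) = gaussianReal m (Real.toNNReal (σ ^ 2)))
    {s : ℝ} (hs0 : 0 ≤ s) (hs : s < 1) (n : ℕ) :
    ∫⁻ ω, ENNReal.ofReal
        (Real.exp (s * (n * (sampleMean (fun i => Z i ω) n - m) ^ 2 / (2 * σ ^ 2)))) ∂P
      ≤ ENNReal.ofReal (√(1 - s))⁻¹ := by
  rcases Nat.eq_zero_or_pos n with rfl | hn
  · simp only [CharP.cast_eq_zero, zero_mul, zero_div, mul_zero, Real.exp_zero, ENNReal.ofReal_one,
      lintegral_const, measure_univ, mul_one]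
    rw [← ENNReal.ofReal_one]
    refine ENNReal.ofReal_le_ofReal ((one_le_inv₀ (Real.sqrt_pos.mpr (by linarith))).mpr ?_)
    exact Real.sqrt_le_one.mpr (by linarith)
  · have hn' : (0 : ℝ) < n := by exact_mod_cast hn
    have hv : (n : NNReal) * Real.toNNReal (σ ^ 2) ≠ 0 :=
      mul_ne_zero (by positivity) (by simpa using hσ.ne')
    rw [← lintegral_exp_mul_sq_of_gaussian (by fun_prop) hv (map_sum_of_gaussian hZ hind hlaw n) hs]
    refine le_of_eq (lintegral_congr fun ω => ?_)
    congr 3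
    rw [NNReal.coe_mul, Real.coe_toNNReal _ (by positivity), NNReal.coe_natCast, sampleMean]
    field_simp

theorem real_le_mul_exp_neg [IsProbabilityMeasure P] {H : Ω → ℝ} (hH : Measurable H) {s c : ℝ}
    (hs : 0 ≤ s) (hc : 0 ≤ c)
    (h : ∫⁻ ω, ENNReal.ofReal (Real.exp (s * H ω)) ∂P ≤ ENNReal.ofReal c) (x : ℝ) :
    P.real {ω | x ≤ H ω} ≤ c * Real.exp (-(s * x)) := by
  have h1 : P {ω | x ≤ H ω} ≤ ENNReal.ofReal c / ENNReal.ofReal (Real.exp (s * x)) := by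
    refine le_trans (measure_mono ?_) ((meas_ge_le_lintegral_div
      (f := fun ω => ENNReal.ofReal (Real.exp (s * H ω))) (by fun_prop)
      (ε := ENNReal.ofReal (Real.exp (s * x))) (by simp [Real.exp_pos]) (by simp)).trans
      (ENNReal.div_le_div_right h _))
    intro ω hω
    exact ENNReal.ofReal_le_ofReal (Real.exp_le_exp.mpr (mul_le_mul_of_nonneg_left hω hs))
  rw [← ENNReal.ofReal_div_of_pos (Real.exp_pos _)] at h1
  rw [Real.exp_neg, ← div_eq_mul_inv]
  exact ENNReal.toReal_le_of_le_ofReal (by positivity) h1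

/-- Exponential moment at `s = 1/2`. The exponent is half the sharp one, which is enough because
these tails only enter the `O(1/ε²)` error. -/
theorem real_sampleMean_tail_le [IsProbabilityMeasure P] {Z : ℕ → Ω → ℝ}
    (hZ : ∀ i, Measurable (Z i)) (hind : iIndepFun Z P) {m σ : ℝ} (hσ : 0 < σ)
    (hlaw : ∀ i, P.map (Z i) = gaussianReal m (Real.toNNReal (σ ^ 2))) {ε : ℝ} (hε : 0 < ε)
    (n : ℕ) :
    P.real {ω | m + ε < sampleMean (fun i => Z i ω) n}
      ≤ 2 * Real.exp (-(n * (ε ^ 2 / (4 * σ ^ 2)))) := by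
  have hS := measurable_sampleMean hZ n
  have h1 := real_le_mul_exp_neg (P := P) (s := 1 / 2) (c := (√(1 - 1 / 2))⁻¹)
    (H := fun ω => n * (sampleMean (fun i => Z i ω) n - m) ^ 2 / (2 * σ ^ 2))
    (by fun_prop) (by norm_num) (by positivity)
    (lintegral_exp_mul_sampleMean_le hZ hind hσ hlaw (by norm_num) (by norm_num) n)
    (n * ε ^ 2 / (2 * σ ^ 2))
  have h2 : (√(1 - 1 / 2 : ℝ))⁻¹ ≤ 2 := by
    rw [inv_le_comm₀ (by positivity) (by norm_num)]
    exact Real.le_sqrt_of_sq_le (by norm_num)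
  refine (measureReal_mono ?_).trans (h1.trans ?_)
  · intro ω hω
    have : ε ≤ sampleMean (fun i => Z i ω) n - m := by
      have := Set.mem_ofPred_eq ▸ hω; linarith
    simp only [Set.mem_ofPred_eq]
    gcongr
  · refine (mul_le_mul_of_nonneg_right h2 (Real.exp_pos _).le).trans_eq ?_
    congr 3
    field_simp
    ring

end Gaussian

/-! ### Deviations of the source mean -/

/-- The normalized squared deviation of the source mean from `m`; it vanishes for infinitely many
samples. -/
noncomputable def sourceDeviation (σ' m : ℝ) (y : ℕ → ℝ) : ℕ∞ → ℝ
  | some n => n * (sampleMean y n - m) ^ 2 / (2 * σ' ^ 2)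
  | none => 0

/-- The source mean of finitely many samples exceeds `m`. -/
def SourceExceeds (m : ℝ) (y : ℕ → ℝ) : ℕ∞ → Prop
  | some n => m < sampleMean y n
  | none => False

theorem sourceDeviation_coe (σ' m : ℝ) (y : ℕ → ℝ) (n : ℕ) :
    sourceDeviation σ' m y n = n * (sampleMean y n - m) ^ 2 / (2 * σ' ^ 2) := rfl

theorem sourceDeviation_top (σ' m : ℝ) (y : ℕ → ℝ) : sourceDeviation σ' m y ⊤ = 0 := rfl

theorem sourceExceeds_coe (m : ℝ) (y : ℕ → ℝ) (n : ℕ) :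
    SourceExceeds m y n ↔ m < sampleMean y n := Iff.rfl

theorem sourceExceeds_top (m : ℝ) (y : ℕ → ℝ) : ¬ SourceExceeds m y ⊤ := id

theorem sourceMean_coe (y : ℕ → ℝ) (n : ℕ) : sourceMean y n = sampleMean y n := rfl

theorem sourcePenalty_coe (σ' : ℝ) (n : ℕ) (c q : ℝ) :
    sourcePenalty σ' n c q = ENNReal.ofReal (n * ((max (q - c) 0) ^ 2 / (2 * σ' ^ 2))) := by
  rw [sourcePenalty, ENNReal.ofReal_mul (by positivity), ENNReal.ofReal_natCast,
    ENat.toENNReal_coe]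

theorem sourcePenalty_eq_zero (σ' : ℝ) (n' : ℕ∞) {c q : ℝ} (h : q ≤ c) :
    sourcePenalty σ' n' c q = 0 := by
  simp [sourcePenalty, max_eq_right (sub_nonpos.mpr h)]

theorem sourcePenalty_top {σ' : ℝ} (hσ' : 0 < σ') {c q : ℝ} (h : c < q) :
    sourcePenalty σ' ⊤ c q = ⊤ := by
  rw [sourcePenalty, ENat.toENNReal_top, ENNReal.top_mul]
  have h1 : 0 < max (q - c) 0 := lt_max_of_lt_left (sub_pos.mpr h)
  exact (ENNReal.ofReal_pos.mpr (by positivity)).ne'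

/-- The shift `c` covers the bias between source and target, so a positive penalty can only come
from the source mean falling below `m'`. -/
theorem sourcePenalty_le_sourceDeviation {σ' : ℝ} {n' : ℕ∞} {y : ℕ → ℝ} {m' c q : ℝ}
    (htop : n' = ⊤ → sourceMean y n' = m') (h : q - c ≤ m') :
    sourcePenalty σ' n' (sourceMean y n' + c) q ≤
      ENNReal.ofReal (sourceDeviation σ' m' y n') := by
  induction n' using ENat.recTopCoe with
  | top => rw [sourcePenalty_eq_zero _ _ (by rw [htop rfl]; linarith)]; exact zero_le
  | coe n =>
    rw [sourcePenalty_coe, sourceDeviation_coe, sourceMean_coe, mul_div_assoc]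
    refine ENNReal.ofReal_le_ofReal ?_
    have h1 : max (q - (sampleMean y n + c)) 0 ^ 2 ≤ (sampleMean y n - m') ^ 2 := by
      rw [← sq_abs (sampleMean y n - m')]
      refine pow_le_pow_left₀ (le_max_right _ _) (max_le ?_ (abs_nonneg _)) 2
      rw [abs_sub_comm]
      exact le_trans (by linarith) (le_abs_self _)
    gcongr

/-- If the penalty of an arm at a point at least `ε` below its mean exceeds `x`, then the squared
deviations of the empirical means are large, either with or without the reward samples. -/
theorem le_deviation_of_lt_penalty {σ σ' : ℝ} (hσ : 0 < σ) {n : ℕ} {n' : ℕ∞} {y : ℕ → ℝ}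
    {m m' c s x ε : ℝ} (hε : 0 < ε) (htop : n' = ⊤ → sourceMean y n' = m') (hc : m - m' ≤ c)
    (h : ENNReal.ofReal x < penalty σ σ' n n' s (sourceMean y n' + c) (m - ε)) :
    x ≤ sourceDeviation σ' m' y n' ∨
      x + n * (ε ^ 2 / (2 * σ ^ 2)) ≤
        n * (s - m) ^ 2 / (2 * σ ^ 2) + sourceDeviation σ' m' y n' := by
  have hH : 0 ≤ sourceDeviation σ' m' y n' := by
    induction n' using ENat.recTopCoe with
    | top => exact le_rfl
    | coe n => rw [sourceDeviation_coe]; positivity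
  have h1 : x < n * (max (m - ε - s) 0) ^ 2 / (2 * σ ^ 2) + sourceDeviation σ' m' y n' := by
    have h2 := h.trans_le (add_le_add_right
      (sourcePenalty_le_sourceDeviation (σ' := σ') htop (c := c) (q := m - ε) (by linarith)) _)
    rw [← ENNReal.ofReal_add (by positivity) hH] at h2
    exact (ENNReal.ofReal_lt_ofReal_iff'.mp h2).1
  rcases le_total (m - ε - s) 0 with hs | hs
  · left
    rw [max_eq_right hs] at h1
    simpa using h1.le
  · right
    rw [max_eq_left hs] at h1
    -- With `u = m - s ≥ ε` one has `(u - ε)² + ε² ≤ u²`: the origin of the extra `n ε² / (2σ²)`.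
    have h3 : n * (m - ε - s) ^ 2 / (2 * σ ^ 2) + n * (ε ^ 2 / (2 * σ ^ 2))
        ≤ n * (s - m) ^ 2 / (2 * σ ^ 2) := by
      rw [← mul_div_assoc, ← add_div, ← mul_add]
      have : (m - ε - s) ^ 2 + ε ^ 2 ≤ (s - m) ^ 2 := by nlinarith
      gcongr
    linarith

theorem sum_exp_neg_le {x : ℝ} (hx : 0 < x) (t : ℕ) :
    ∑ n ∈ Finset.range t, Real.exp (-(n * x)) ≤ 1 + 1 / x := by
  have h1 : ∀ n : ℕ, Real.exp (-(n * x)) = Real.exp (-x) ^ n := fun n => by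
    rw [← Real.exp_nat_mul]; congr 1; ring
  simp_rw [h1]
  have h2 : Real.exp (-x) ≤ 1 / (1 + x) := by
    rw [Real.exp_neg, ← one_div]
    exact one_div_le_one_div_of_le (by linarith) (by linarith [Real.add_one_le_exp x])
  have h3 : Real.exp (-x) < 1 := by simpa using hx
  refine ((summable_geometric_of_lt_one (Real.exp_pos _).le h3).sum_le_tsum _
    (fun _ _ => by positivity)).trans ?_
  rw [tsum_geometric_of_lt_one (Real.exp_pos _).le h3, inv_le_comm₀ (by linarith) (by positivity)]
  have h4 : (1 + 1 / x)⁻¹ = 1 - 1 / (1 + x) := by field_simp; ring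
  linarith

/-! ### Joint deviations of target and source means -/

section Model

variable {K : ℕ} {Ω : Type u} [MeasurableSpace Ω] {P : Measure Ω}
  {μ μ' : Fin K → ℝ} {σ σ' : ℝ} {X Y : Fin K → ℕ → Ω → ℝ}

theorem IsGaussianTransferModel.iIndepFun_target
    (hM : IsGaussianTransferModel P μ μ' σ σ' X Y) (k : Fin K) : iIndepFun (X k) P :=
  hM.indep.precomp (g := fun i : ℕ => Sum.inl (k, i)) fun i j h => by simpa using h

theorem IsGaussianTransferModel.iIndepFun_source
    (hM : IsGaussianTransferModel P μ μ' σ σ' X Y) (k : Fin K) : iIndepFun (Y k) P :=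
  hM.indep.precomp (g := fun i : ℕ => Sum.inr (k, i)) fun i j h => by simpa using h

theorem IsGaussianTransferModel.indepFun_sampleMean
    (hM : IsGaussianTransferModel P μ μ' σ σ' X Y) (k : Fin K) (n n' : ℕ) :
    IndepFun (fun ω => sampleMean (fun i => X k i ω) n)
      (fun ω => sampleMean (fun i => Y k i ω) n') P := by
  classical
  let S : Finset (Fin K × ℕ ⊕ Fin K × ℕ) :=
    (Finset.range n).map ⟨fun i => Sum.inl (k, i), fun i j h => by simpa using h⟩
  let S' : Finset (Fin K × ℕ ⊕ Fin K × ℕ) :=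
    (Finset.range n').map ⟨fun i => Sum.inr (k, i), fun i j h => by simpa using h⟩
  have hd : Disjoint S S' := by
    rw [Finset.disjoint_left]
    intro x hx hx'
    simp only [S, S', Finset.mem_map] at hx hx'
    obtain ⟨i, -, rfl⟩ := hx
    obtain ⟨j, -, hj⟩ := hx'
    exact absurd hj (by simp)
  have h := hM.indep.indepFun_finset S S' hd (by
    rintro (p | p)
    · exact hM.measurable_target _ _
    · exact hM.measurable_source _ _)
  have h2 := h.comp (φ := fun z : S → ℝ => (∑ i, z i) / (n : ℝ))
    (ψ := fun z : S' → ℝ => (∑ i, z i) / (n' : ℝ)) (by fun_prop) (by fun_prop)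
  convert h2 using 1
  · ext ω
    rw [Function.comp_apply, Finset.sum_coe_sort S fun i =>
      (Sum.elim (fun p : Fin K × ℕ => X p.1 p.2) (fun p : Fin K × ℕ => Y p.1 p.2)) i ω,
      Finset.sum_map]
    rfl
  · ext ω
    rw [Function.comp_apply, Finset.sum_coe_sort S' fun i =>
      (Sum.elim (fun p : Fin K × ℕ => X p.1 p.2) (fun p : Fin K × ℕ => Y p.1 p.2)) i ω,
      Finset.sum_map]
    rfl

theorem IsGaussianTransferModel.sourceMean_top
    (hM : IsGaussianTransferModel P μ μ' σ σ' X Y) (k : Fin K) :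
    ∀ᵐ ω ∂P, sourceMean (fun i => Y k i ω) ⊤ = μ' k := by
  have hint : ∀ i, Integrable (Y k i) P := fun i => by
    have : Integrable id (P.map (Y k i)) := by
      rw [hM.law_source]
      exact (memLp_id_gaussianReal' 1 (by simp)).integrable le_rfl
    exact (integrable_map_measure (by fun_prop) (hM.measurable_source k i).aemeasurable).mp this
  have hE : P[Y k 0] = μ' k := by
    rw [← integral_id_gaussianReal (μ := μ' k) (v := Real.toNNReal (σ' ^ 2)), ← hM.law_source k 0,
      integral_map (hM.measurable_source k 0).aemeasurable (by fun_prop)]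
  have hslln := strong_law_ae_real (Y k) (hint 0)
    (fun i j hij => (hM.iIndepFun_source k).indepFun hij)
    (fun i => ⟨(hM.measurable_source k i).aemeasurable, (hM.measurable_source k 0).aemeasurable,
      by rw [hM.law_source, hM.law_source]⟩)
  filter_upwards [hslln] with ω hω
  rw [hE] at hω
  exact hω.limUnder_eq

theorem IsGaussianTransferModel.measurable_sourceDeviation
    (hM : IsGaussianTransferModel P μ μ' σ σ' X Y) (k : Fin K) (n' : ℕ∞) :
    Measurable fun ω => sourceDeviation σ' (μ' k) (fun i => Y k i ω) n' := by
  induction n' using ENat.recTopCoe with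
  | top => simp only [sourceDeviation_top]; fun_prop
  | coe n =>
    have := measurable_sampleMean (hM.measurable_source k) n
    simp only [sourceDeviation_coe]
    fun_prop

/-- Each of the two independent means contributes a factor `(1 - s)^(-1/2)`; for `n' = ⊤` the source
factor is `1`. -/
theorem IsGaussianTransferModel.lintegral_exp_mul_deviation_le [IsProbabilityMeasure P]
    (hM : IsGaussianTransferModel P μ μ' σ σ' X Y) (hσ : 0 < σ) (hσ' : 0 < σ') (k : Fin K)
    (n : ℕ) (n' : ℕ∞) {s : ℝ} (hs0 : 0 ≤ s) (hs : s < 1) :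
    ∫⁻ ω, ENNReal.ofReal (Real.exp (s *
        (n * (sampleMean (fun i => X k i ω) n - μ k) ^ 2 / (2 * σ ^ 2)
          + sourceDeviation σ' (μ' k) (fun i => Y k i ω) n'))) ∂P
      ≤ ENNReal.ofReal (1 - s)⁻¹ := by
  have hX := lintegral_exp_mul_sampleMean_le (hM.measurable_target k) (hM.iIndepFun_target k) hσ
    (hM.law_target k) hs0 hs n
  have hpos : 0 < 1 - s := by linarith
  induction n' using ENat.recTopCoe with
  | top =>
    simp only [sourceDeviation_top, add_zero]
    refine hX.trans (ENNReal.ofReal_le_ofReal ?_)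
    gcongr
    exact Real.le_sqrt_of_sq_le (by nlinarith)
  | coe n' =>
    have hY := lintegral_exp_mul_sampleMean_le (hM.measurable_source k) (hM.iIndepFun_source k) hσ'
      (hM.law_source k) hs0 hs n'
    simp only [sourceDeviation_coe]
    have hind := (hM.indepFun_sampleMean k n n').comp
      (φ := fun z : ℝ => ENNReal.ofReal (Real.exp (s * (n * (z - μ k) ^ 2 / (2 * σ ^ 2)))))
      (ψ := fun z : ℝ => ENNReal.ofReal (Real.exp (s * (n' * (z - μ' k) ^ 2 / (2 * σ' ^ 2)))))
      (by fun_prop) (by fun_prop)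
    have hmX := measurable_sampleMean (hM.measurable_target k) n
    have hmY := measurable_sampleMean (hM.measurable_source k) n'
    have hprod := lintegral_mul_eq_lintegral_mul_lintegral_of_indepFun
      (by fun_prop) (by fun_prop) hind
    simp only [Pi.mul_apply, Function.comp_apply] at hprod
    simp_rw [mul_add, Real.exp_add, ENNReal.ofReal_mul (Real.exp_pos _).le]
    rw [hprod]
    refine (mul_le_mul' hX hY).trans_eq ?_
    rw [← ENNReal.ofReal_mul (by positivity), ← mul_inv, Real.mul_self_sqrt hpos.le]

/-- The deviation event which contains the failure of the confidence bound of arm `k` in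
round `t`. -/
def deviationEvent (μ μ' : Fin K → ℝ) (σ σ' : ℝ) (X Y : Fin K → ℕ → Ω → ℝ) (k : Fin K) (n' : ℕ∞)
    (ε x : ℝ) (t : ℕ) : Set Ω :=
  ⋃ n ∈ Finset.range t, {ω | x + n * (ε ^ 2 / (2 * σ ^ 2)) ≤
    n * (sampleMean (fun i => X k i ω) n - μ k) ^ 2 / (2 * σ ^ 2)
      + sourceDeviation σ' (μ' k) (fun i => Y k i ω) n'}

theorem IsGaussianTransferModel.measurableSet_deviationEvent
    (hM : IsGaussianTransferModel P μ μ' σ σ' X Y) (k : Fin K) (n' : ℕ∞) (ε x : ℝ) (t : ℕ) :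
    MeasurableSet (deviationEvent μ μ' σ σ' X Y k n' ε x t) := by
  refine Finset.measurableSet_biUnion _ fun n _ => measurableSet_le (by fun_prop) ?_
  have h1 := measurable_sampleMean (hM.measurable_target k) n
  have h2 := hM.measurable_sourceDeviation k n'
  fun_prop

/-- Markov's inequality for each `n`, then a geometric sum over `n` that does not grow with `t`. -/
theorem IsGaussianTransferModel.real_deviationEvent_le [IsProbabilityMeasure P]
    (hM : IsGaussianTransferModel P μ μ' σ σ' X Y) (hσ : 0 < σ) (hσ' : 0 < σ') (k : Fin K)
    (n' : ℕ∞) {ε x : ℝ} (hε : 0 < ε) (hx : 2 ≤ x) (t : ℕ) :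
    P.real (deviationEvent μ μ' σ σ' X Y k n' ε x t)
      ≤ x * Real.exp (1 - x) * (1 + 4 * σ ^ 2 / ε ^ 2) := by
  have hκ : 0 < ε ^ 2 / (4 * σ ^ 2) := by positivity
  have hx0 : 0 < x := by linarith
  have hx1 : 1 / x ≤ 1 / 2 := one_div_le_one_div_of_le (by norm_num) hx
  have hx2 : 0 < 1 / x := by positivity
  have hstep : ∀ n : ℕ, P.real {ω | x + n * (ε ^ 2 / (2 * σ ^ 2)) ≤
      n * (sampleMean (fun i => X k i ω) n - μ k) ^ 2 / (2 * σ ^ 2)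
        + sourceDeviation σ' (μ' k) (fun i => Y k i ω) n'}
      ≤ x * Real.exp (1 - x) * Real.exp (-(n * (ε ^ 2 / (4 * σ ^ 2)))) := by
    intro n
    have h1 := measurable_sampleMean (hM.measurable_target k) n
    have h2 := hM.measurable_sourceDeviation k n'
    -- `s = 1 - 1/x` minimizes `(1 - s)⁻¹ e^(-s x)`; `x ≥ 2` gives `s ≥ 1/2`, which keeps half of
    -- the extra exponent.
    have h3 := real_le_mul_exp_neg (P := P) (s := 1 - 1 / x) (c := x)
      (H := fun ω => n * (sampleMean (fun i => X k i ω) n - μ k) ^ 2 / (2 * σ ^ 2)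
        + sourceDeviation σ' (μ' k) (fun i => Y k i ω) n')
      (by fun_prop) (by linarith) hx0.le
      ((hM.lintegral_exp_mul_deviation_le hσ hσ' k n n' (by linarith) (by linarith)).trans_eq
        (by simp)) (x + n * (ε ^ 2 / (2 * σ ^ 2)))
    refine h3.trans ?_
    rw [mul_assoc x, ← Real.exp_add]
    refine mul_le_mul_of_nonneg_left (Real.exp_le_exp.mpr ?_) hx0.le
    have h4 : (1 - 1 / x) * x = x - 1 := by field_simp
    have h5 : ε ^ 2 / (2 * σ ^ 2) = 2 * (ε ^ 2 / (4 * σ ^ 2)) := by field_simp; ring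
    have h6 : 0 ≤ (n : ℝ) * (ε ^ 2 / (4 * σ ^ 2)) := by positivity
    rw [h5, mul_add, h4]
    nlinarith
  refine (measureReal_biUnion_finset_le _ _).trans
    ((Finset.sum_le_sum fun n _ => hstep n).trans ?_)
  rw [← Finset.mul_sum]
  refine mul_le_mul_of_nonneg_left ((sum_exp_neg_le hκ t).trans_eq ?_) (by positivity)
  field_simp

end Model

/-! ### Summation over the rounds -/

theorem two_le_explorationLevel {t : ℕ} (ht : 8 ≤ t) : 2 ≤ explorationLevel t := by
  have h1 : Real.log 8 ≤ Real.log t := Real.log_le_log (by norm_num) (by exact_mod_cast ht)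
  have h2 : Real.log 8 = 3 * Real.log 2 := by
    rw [show (8 : ℝ) = 2 ^ 3 by norm_num, Real.log_pow]; norm_num
  have h3 : 0 ≤ Real.log (max 1 (Real.log t)) := Real.log_nonneg (le_max_left _ _)
  have := Real.log_two_gt_d9
  unfold explorationLevel
  linarith

theorem explorationLevel_mul_exp_le {t : ℕ} (ht : 8 ≤ t) :
    explorationLevel t * Real.exp (1 - explorationLevel t) ≤
      12 * (1 / (t * Real.log t ^ 2)) := by
  have ht0 : (0 : ℝ) < t := by positivity
  have h1 : 1 ≤ Real.log t := by
    rw [Real.le_log_iff_exp_le ht0]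
    have : (8 : ℝ) ≤ t := by exact_mod_cast ht
    linarith [Real.exp_one_lt_three]
  have hl : 0 < Real.log t := by linarith
  have h2 : explorationLevel t = Real.log t + 3 * Real.log (Real.log t) := by
    rw [explorationLevel, max_eq_right h1]
  have h3 : explorationLevel t ≤ 4 * Real.log t := by
    rw [h2]; linarith [Real.log_le_sub_one_of_pos hl]
  have h4 : Real.exp (1 - explorationLevel t) = Real.exp 1 / (t * Real.log t ^ 3) := by
    rw [Real.exp_sub, h2, Real.exp_add, Real.exp_log ht0, mul_comm 3, Real.exp_mul,
      Real.exp_log hl]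
    norm_cast
  calc explorationLevel t * Real.exp (1 - explorationLevel t)
      ≤ 4 * Real.log t * (3 / (t * Real.log t ^ 3)) := by
        rw [h4]
        gcongr
        exact Real.exp_one_lt_three.le
    _ = 12 * (1 / (t * Real.log t ^ 2)) := by field_simp; norm_num

/-- Telescoping: each term is at most `1 / ln (t - 1) - 1 / ln t`. -/
theorem sum_one_div_mul_log_sq_le (T : ℕ) :
    ∑ t ∈ Finset.Icc 8 T, 1 / ((t : ℝ) * Real.log t ^ 2) ≤ 1 := by
  have hlog : ∀ t : ℕ, 7 ≤ t → 1 ≤ Real.log t := fun t ht => by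
    rw [Real.le_log_iff_exp_le (by positivity)]
    have : (7 : ℝ) ≤ t := by exact_mod_cast ht
    linarith [Real.exp_one_lt_three]
  rcases lt_or_ge T 7 with hT | hT
  · rw [Finset.Icc_eq_empty (by omega)]; simp
  have key : ∑ t ∈ Finset.Icc 8 T, 1 / ((t : ℝ) * Real.log t ^ 2)
      ≤ 1 / Real.log (7 : ℕ) - 1 / Real.log T := by
    induction T, hT using Nat.le_induction with
    | base => simp
    | succ t ht ih =>
      rw [Finset.sum_Icc_succ_top (by omega)]
      have ha := hlog t ht
      have hb := hlog (t + 1) (by omega)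
      have ht0 : (0 : ℝ) < t := by positivity
      have hmono : Real.log t ≤ Real.log (t + 1 : ℕ) :=
        Real.log_le_log ht0 (by push_cast; linarith)
      have hdiff : 1 / ((t + 1 : ℕ) : ℝ) ≤ Real.log (t + 1 : ℕ) - Real.log t := by
        have h := Real.log_le_sub_one_of_pos (x := (t : ℝ) / (t + 1 : ℕ)) (by positivity)
        rw [Real.log_div (by positivity) (by positivity)] at h
        have h' : (t : ℝ) / (t + 1 : ℕ) - 1 = -(1 / ((t + 1 : ℕ) : ℝ)) := by
          push_cast; field_simp; ring
        linarith
      have hstep : 1 / (((t + 1 : ℕ) : ℝ) * Real.log (t + 1 : ℕ) ^ 2)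
          ≤ 1 / Real.log t - 1 / Real.log (t + 1 : ℕ) := by
        have hp : 0 < Real.log t := by linarith
        have hq : 0 < Real.log (t + 1 : ℕ) := by linarith
        rw [div_sub_div _ _ hp.ne' hq.ne', one_mul, mul_one, ← div_div]
        exact div_le_div₀ (by linarith) hdiff (by positivity) (by rw [sq]; gcongr)
      linarith
  have h7 : 1 / Real.log (7 : ℕ) ≤ 1 := by
    rw [div_le_one (by linarith [hlog 7 le_rfl])]; exact hlog 7 le_rfl
  have hT0 : 0 ≤ 1 / Real.log T := by
    have := hlog T hT; positivity
  linarith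

/-! ### The suboptimal arm -/

/-- Replacing the source mean by its expectation in the residual exploration budget. -/
theorem toReal_sub_sourcePenalty_le {σ' : ℝ} (hσ' : 0 < σ') {n' : ℕ∞} {y : ℕ → ℝ}
    {m m' c ε l x b : ℝ} (hε : 0 < ε) (hl : 0 ≤ l) (hlx : l ≤ x)
    (htop : n' = ⊤ → sourceMean y n' = m') (hb : b = max (m - m' - c) 0)
    (hεb : b = 0 ∨ 12 * ε ≤ b) :
    (ENNReal.ofReal x - sourcePenalty σ' n' (sourceMean y n' + c) (m - 2 * ε)).toReal ≤
      (ENNReal.ofReal l - sourcePenalty σ' n' (m' + c) m).toReal + (x - l) + 12 / b * ε * l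
        + n'.toNat * (b ^ 2 / (2 * σ' ^ 2)) *
          Set.indicator {y | SourceExceeds (m' + ε) y n'} 1 y := by
  have hb0 : 0 ≤ b := hb ▸ le_max_right _ _
  -- For `b = 0` the quotient `12 / b` is `0`; no error term is needed, as the target residual then
  -- contains no penalty.
  have hlb : 0 ≤ 12 / b * ε * l := by positivity
  induction n' using ENat.recTopCoe with
  | top =>
    rw [htop rfl, ENat.toNat_top, Nat.cast_zero, zero_mul, zero_mul, add_zero]
    rcases hεb with h0 | h0
    · have h1 : m - m' - c ≤ 0 := by rw [h0] at hb; exact (le_max_left _ _).trans hb.ge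
      rw [sourcePenalty_eq_zero _ _ (by linarith), sourcePenalty_eq_zero _ _ (by linarith),
        tsub_zero, tsub_zero, ENNReal.toReal_ofReal hl, ENNReal.toReal_ofReal (hl.trans hlx)]
      linarith
    · have h1 : b = m - m' - c := by
        rcases max_choice (m - m' - c) 0 with h | h <;> rw [h] at hb <;> linarith
      rw [sourcePenalty_top hσ' (by linarith), ENNReal.sub_top, ENNReal.toReal_zero]
      have := @ENNReal.toReal_nonneg (ENNReal.ofReal l - sourcePenalty σ' ⊤ (m' + c) m)
      linarith
  | coe n =>
    rw [sourcePenalty_coe, sourcePenalty_coe, sourceMean_coe,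
      ← ENNReal.ofReal_sub _ (by positivity), ← ENNReal.ofReal_sub _ (by positivity),
      ENNReal.toReal_ofReal', ENNReal.toReal_ofReal', ENat.toNat_natCast, ← sub_sub m m' c, ← hb]
    set D := (n : ℝ) * (b ^ 2 / (2 * σ' ^ 2)) with hD
    set p := (n : ℝ) * (max (m - 2 * ε - (sampleMean y n + c)) 0 ^ 2 / (2 * σ' ^ 2)) with hp
    have hD0 : 0 ≤ D := by positivity
    have hp0 : 0 ≤ p := by positivity
    have hr := le_max_left (l - D) 0
    have hr0 := le_max_right (l - D) 0
    by_cases hS : SourceExceeds (m' + ε) y n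
    -- A badly overestimated source mean may lose the whole source penalty `D`, which the last term
    -- pays for.
    · rw [Set.indicator_of_mem (by exact hS), Pi.one_apply, mul_one]
      exact max_le (by linarith) (by linarith)
    · rw [Set.indicator_of_notMem (by exact hS), mul_zero, add_zero]
      rw [sourceExceeds_coe, not_lt] at hS
      rcases hεb with h0 | h0
      · have : D = 0 := by rw [hD, h0]; simp
        exact max_le (by linarith) (by linarith)
      · have hbpos : 0 < b := by linarith
        have h1 : b = m - m' - c := by
          rcases max_choice (m - m' - c) 0 with h | h <;> rw [h] at hb <;> linarith
        set v := ε / b with hv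
        have hv0 : 0 ≤ v := by positivity
        have hv1 : v ≤ 1 / 12 := by rw [hv, div_le_iff₀ hbpos]; linarith
        have hεv : ε = v * b := by rw [hv]; field_simp
        have h2 : (1 - 6 * v) * b ^ 2 ≤ max (m - 2 * ε - (sampleMean y n + c)) 0 ^ 2 := by
          have h3 : b - 3 * ε ≤ max (m - 2 * ε - (sampleMean y n + c)) 0 :=
            le_trans (by linarith) (le_max_left _ _)
          refine le_trans ?_ (pow_le_pow_left₀ (by linarith) h3 2)
          rw [hεv]
          nlinarith [mul_nonneg (sq_nonneg v) (sq_nonneg b)]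
        have h4 : (1 - 6 * v) * D ≤ p := by
          rw [hD, hp, mul_left_comm, ← mul_div_assoc]
          gcongr
        have h5 : 12 / b * ε * l = 12 * v * l := by rw [hεv]; field_simp
        rw [h5] at hlb ⊢
        refine max_le ?_ (by linarith)
        -- The penalty loses at most `6 v D`. If `D ≤ 2l` this is at most `12 v l`; if `D ≥ 2l`,
        -- then `(1 - 6v) D ≥ D / 2 ≥ l` and only `x - l` can remain.
        rcases le_total D (2 * l) with h6 | h6
        · nlinarith
        · nlinarith

/-- A sample size is either exceptional, with `s n > r`, or so small that its reward penalty fits in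
the budget left by the source. The `1` accounts for `n = 0`. -/
theorem card_penalty_le {σ σ' : ℝ} (hσ : 0 < σ) {n' : ℕ∞} {s : ℕ → ℝ} {c q r x : ℝ} (hrq : r < q)
    (T : ℕ) :
    (({n ∈ Finset.range T | penalty σ σ' n n' (s n) c q ≤ ENNReal.ofReal x}.card : ℕ) : ℝ) ≤
      ∑ n ∈ Finset.range T, Set.indicator {z | r < z} (1 : ℝ → ℝ) (s n)
        + (1 + 2 * σ ^ 2 / (q - r) ^ 2 * (ENNReal.ofReal x - sourcePenalty σ' n' c q).toReal) := by
  classical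
  set R := (ENNReal.ofReal x - sourcePenalty σ' n' c q).toReal with hR
  set z := 2 * σ ^ 2 / (q - r) ^ 2 * R with hz
  have hg : 0 < q - r := sub_pos.mpr hrq
  have hz0 : 0 ≤ z := mul_nonneg (by positivity) ENNReal.toReal_nonneg
  have hsub : {n ∈ Finset.range T | penalty σ σ' n n' (s n) c q ≤ ENNReal.ofReal x} ⊆
      {n ∈ Finset.range T | r < s n} ∪ Finset.range (⌊z⌋₊ + 1) := by
    intro n hn
    rw [Finset.mem_filter] at hn
    rw [Finset.mem_union, Finset.mem_filter]
    by_cases hs : r < s n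
    · exact Or.inl ⟨hn.1, hs⟩
    · right
      rw [not_lt] at hs
      have h1 := hn.2
      unfold penalty at h1
      have hfin : sourcePenalty σ' n' c q ≠ ⊤ :=
        ne_top_of_le_ne_top ENNReal.ofReal_ne_top (le_add_self.trans h1)
      have h2 := ENNReal.toReal_mono (ENNReal.sub_ne_top ENNReal.ofReal_ne_top)
        (ENNReal.le_sub_of_add_le_right hfin h1)
      rw [ENNReal.toReal_ofReal (by positivity), ← hR] at h2
      have h3 : (n : ℝ) * (q - r) ^ 2 / (2 * σ ^ 2) ≤ R := by
        refine le_trans ?_ h2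
        have : q - r ≤ max (q - s n) 0 := le_trans (by linarith) (le_max_left _ _)
        gcongr
      rw [Finset.mem_range, Nat.lt_succ_iff]
      refine Nat.le_floor ?_
      rw [hz, div_mul_eq_mul_div, le_div_iff₀ (by positivity)]
      rw [div_le_iff₀ (by positivity)] at h3
      linarith
  have hcard := (Finset.card_le_card hsub).trans (Finset.card_union_le _ _)
  rw [Finset.card_range] at hcard
  have hind : (({n ∈ Finset.range T | r < s n}.card : ℕ) : ℝ)
      = ∑ n ∈ Finset.range T, Set.indicator {z | r < z} (1 : ℝ → ℝ) (s n) := by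
    rw [Finset.card_filter]
    push_cast
    rfl
  rw [← hind]
  have hfl := Nat.floor_le hz0
  have : (({n ∈ Finset.range T | penalty σ σ' n n' (s n) c q ≤ ENNReal.ofReal x}.card : ℕ) : ℝ)
      ≤ ({n ∈ Finset.range T | r < s n}.card : ℕ) + (⌊z⌋₊ + 1 : ℕ) := by exact_mod_cast hcard
  push_cast at this
  linarith

/-! ### The regret bound at a fixed resolution `ε` -/

theorem mem_deviationEvent_of_index_lt {K : ℕ} {Ω : Type*} {μ μ' : Fin K → ℝ} {σ σ' : ℝ}
    {X Y : Fin K → ℕ → Ω → ℝ} (hσ : 0 < σ) {L : Fin K → ℝ} {N' : Fin K → ℕ∞}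
    {A : ℕ → Ω → Fin K} {k : Fin K} {ε : ℝ} (hε : 0 < ε) {ω : Ω}
    (htop : N' k = ⊤ → sourceMean (fun i => Y k i ω) (N' k) = μ' k) (hL : |μ k - μ' k| ≤ L k)
    {t : ℕ} (ht : 1 ≤ t)
    (h : index σ σ' L N' (fun j i => X j i ω) (fun j i => Y j i ω) (fun s => A s ω) k t
      < ((μ k - ε : ℝ) : EReal)) :
    ω ∈ deviationEvent μ μ' σ σ' X Y k (N' k) ε (explorationLevel t) t := by
  have h0 : ENNReal.ofReal (explorationLevel t) <
      penalty σ σ' (pulls (fun s => A s ω) k (t - 1)) (N' k)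
        (sampleMean (fun i => X k i ω) (pulls (fun s => A s ω) k (t - 1)))
        (sourceMean (fun i => Y k i ω) (N' k) + L k) (μ k - ε) :=
    lt_penalty_of_index_lt (x := fun j i => X j i ω) (y := fun j i => Y j i ω)
      (A := fun s => A s ω) (a := k) (t := t) (q := μ k - ε) h
  have h1 := le_deviation_of_lt_penalty (x := explorationLevel t) (m := μ k) (m' := μ' k)
    hσ hε htop ((le_abs_self _).trans hL) h0
  have h2 := pulls_le (fun s => A s ω) k (t - 1)
  unfold deviationEvent
  simp only [Set.mem_iUnion, Finset.mem_range, exists_prop]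
  rcases h1 with h1 | h1
  -- If the source deviation alone exceeds the level, the event already occurs at `n = 0`.
  · refine ⟨0, by omega, ?_⟩
    simpa using h1
  · exact ⟨pulls (fun s => A s ω) k (t - 1), by omega, h1⟩

section Model

variable {K : ℕ} {Ω : Type u} [MeasurableSpace Ω] {P : Measure Ω}
  {μ μ' : Fin K → ℝ} {σ σ' : ℝ} {X Y : Fin K → ℕ → Ω → ℝ}

theorem IsGaussianTransferModel.measurableSet_sourceExceeds
    (hM : IsGaussianTransferModel P μ μ' σ σ' X Y) (k : Fin K) (n' : ℕ∞) (m : ℝ) :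
    MeasurableSet {ω | SourceExceeds m (fun i => Y k i ω) n'} := by
  induction n' using ENat.recTopCoe with
  | top => simp [sourceExceeds_top]
  | coe n =>
    exact measurableSet_lt measurable_const (measurable_sampleMean (hM.measurable_source k) n)

/-- The penalty grows linearly in `n'` while the tail decays exponentially; `x e^(-x) ≤ 1` makes the
product bounded uniformly in `n'`. -/
theorem IsGaussianTransferModel.mul_real_sourceExceeds_le [IsProbabilityMeasure P]
    (hM : IsGaussianTransferModel P μ μ' σ σ' X Y) (hσ' : 0 < σ') (k : Fin K) (n' : ℕ∞) (b : ℝ)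
    {ε : ℝ} (hε : 0 < ε) :
    n'.toNat * (b ^ 2 / (2 * σ' ^ 2)) *
      P.real {ω | SourceExceeds (μ' k + ε) (fun i => Y k i ω) n'} ≤ 4 * b ^ 2 / ε ^ 2 := by
  induction n' using ENat.recTopCoe with
  | top => simp only [ENat.toNat_top, Nat.cast_zero, zero_mul]; positivity
  | coe n =>
    have h := real_sampleMean_tail_le (hM.measurable_source k) (hM.iIndepFun_source k) hσ'
      (hM.law_source k) hε n
    rw [ENat.toNat_natCast]
    refine (mul_le_mul_of_nonneg_left h (by positivity)).trans ?_
    set x := (n : ℝ) * (ε ^ 2 / (4 * σ' ^ 2)) with hx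
    have hx1 : x * Real.exp (-x) ≤ 1 := by
      rw [Real.exp_neg, ← div_eq_mul_inv, div_le_one (Real.exp_pos _)]
      linarith [Real.add_one_le_exp x]
    calc n * (b ^ 2 / (2 * σ' ^ 2)) * (2 * Real.exp (-x))
        = 4 * b ^ 2 / ε ^ 2 * (x * Real.exp (-x)) := by rw [hx]; field_simp
      _ ≤ 4 * b ^ 2 / ε ^ 2 * 1 := by gcongr
      _ = _ := mul_one _

/-- The `8` is seven initial rounds plus the sample size `0`; the `14` is `12` from the best arm's
failures plus `2` from overestimates of `a`. -/
theorem expected_pulls_le [IsProbabilityMeasure P] (hσ : 0 < σ) (hσ' : 0 < σ') {L : Fin K → ℝ}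
    (hL : ∀ k, |μ k - μ' k| ≤ L k) {N' : Fin K → ℕ∞} {A : ℕ → Ω → Fin K}
    (hM : IsGaussianTransferModel P μ μ' σ σ' X Y) (hA : IsPolicyRun σ σ' L N' X Y A)
    {a best : Fin K} {ε b : ℝ} (hε : 0 < ε) (hεΔ : 12 * ε ≤ μ best - μ a)
    (hb : b = max (μ best - μ' a - L a) 0) (hεb : b = 0 ∨ 12 * ε ≤ b) (T : ℕ) :
    ∫ ω, (pulls (fun s => A s ω) a T : ℝ) ∂P ≤
      8 + 14 * (1 + 4 * σ ^ 2 / ε ^ 2)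
        + 2 * σ ^ 2 / (μ best - μ a - 3 * ε) ^ 2 *
          (logResidual σ' (N' a) (μ' a + L a) (μ best) T
            + (explorationLevel T - Real.log T) + 12 / b * ε * Real.log T
            + 4 * b ^ 2 / ε ^ 2) := by
  classical
  set B : ℕ → Set Ω := fun t =>
    deviationEvent μ μ' σ σ' X Y best (N' best) ε (explorationLevel t) t with hB
  set E : ℕ → Set Ω := fun n => {ω | μ a + ε < sampleMean (fun i => X a i ω) n} with hE
  set F : Set Ω := {ω | SourceExceeds (μ' a + ε) (fun i => Y a i ω) (N' a)} with hF
  set κ := 2 * σ ^ 2 / (μ best - μ a - 3 * ε) ^ 2 with hκ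
  set ρ := logResidual σ' (N' a) (μ' a + L a) (μ best) T
            + (explorationLevel T - Real.log T) + 12 / b * ε * Real.log T with hρ
  set D := ((N' a).toNat : ℝ) * (b ^ 2 / (2 * σ' ^ 2)) with hD
  have hBm : ∀ t, MeasurableSet (B t) := fun t => hM.measurableSet_deviationEvent _ _ _ _ _
  have hEm : ∀ n, MeasurableSet (E n) := fun n =>
    measurableSet_lt measurable_const (measurable_sampleMean (hM.measurable_target a) n)
  have hFm : MeasurableSet F := hM.measurableSet_sourceExceeds a (N' a) _
  have hlogT : 0 ≤ Real.log T := Real.log_natCast_nonneg T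
  have hexpl : Real.log T ≤ explorationLevel T := by
    have : 0 ≤ Real.log (max 1 (Real.log T)) := Real.log_nonneg (le_max_left _ _)
    unfold explorationLevel
    linarith
  have hκ0 : 0 ≤ κ := by positivity
  have htop : ∀ᵐ ω ∂P, ∀ k, N' k = ⊤ → sourceMean (fun i => Y k i ω) (N' k) = μ' k := by
    rw [ae_all_iff]
    intro k
    filter_upwards [hM.sourceMean_top k] with ω hω h
    rw [h, hω]
  have hpath : ∀ᵐ ω ∂P, (pulls (fun s => A s ω) a T : ℝ) ≤
      8 + ∑ t ∈ Finset.Icc 8 T, (B t).indicator (1 : Ω → ℝ) ω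
        + ∑ n ∈ Finset.range T, (E n).indicator (1 : Ω → ℝ) ω
        + κ * (ρ + D * F.indicator (1 : Ω → ℝ) ω) := by
    filter_upwards [htop] with ω hω
    have h1 := pulls_le_add (fun t ht k => hA.maximal ω t ht k) a best
      (show μ best - 2 * ε < μ best - ε by linarith) T
    have h2 : {t ∈ Finset.Icc 1 T | index σ σ' L N' (fun j i => X j i ω) (fun j i => Y j i ω)
          (fun s => A s ω) best t < ((μ best - ε : ℝ) : EReal)} ⊆
        Finset.Icc 1 7 ∪ {t ∈ Finset.Icc 8 T | ω ∈ B t} := by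
      intro t ht
      rw [Finset.mem_filter, Finset.mem_Icc] at ht
      rw [Finset.mem_union, Finset.mem_filter, Finset.mem_Icc, Finset.mem_Icc]
      rcases lt_or_ge t 8 with h8 | h8
      · left; omega
      · right
        refine ⟨⟨h8, ht.1.2⟩, ?_⟩
        exact mem_deviationEvent_of_index_lt hσ hε (hω best) (hL best) ht.1.1 ht.2
    have h4 := (Finset.card_le_card h2).trans (Finset.card_union_le _ _)
    have h5 : (({t ∈ Finset.Icc 8 T | ω ∈ B t}.card : ℕ) : ℝ)
        = ∑ t ∈ Finset.Icc 8 T, (B t).indicator (1 : Ω → ℝ) ω := by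
      rw [Finset.card_filter]
      push_cast
      exact Finset.sum_congr rfl fun t _ => by simp [Set.indicator_apply]
    have h6 := card_penalty_le (σ' := σ') hσ (n' := N' a)
      (s := fun n => sampleMean (fun i => X a i ω) n)
      (c := sourceMean (fun i => Y a i ω) (N' a) + L a) (x := explorationLevel T)
      (show μ a + ε < μ best - 2 * ε by linarith) T
    rw [show μ best - 2 * ε - (μ a + ε) = μ best - μ a - 3 * ε by ring] at h6
    have h7 := toReal_sub_sourcePenalty_le hσ' hε hlogT hexpl (hω a) hb hεb
    have h8 := h6.trans (add_le_add_right (add_le_add_right (mul_le_mul_of_nonneg_left h7 hκ0) _) _)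
    have h9 : (({t ∈ Finset.Icc 1 T | index σ σ' L N' (fun j i => X j i ω) (fun j i => Y j i ω)
          (fun s => A s ω) best t < ((μ best - ε : ℝ) : EReal)}.card : ℕ) : ℝ) ≤
        7 + ∑ t ∈ Finset.Icc 8 T, (B t).indicator (1 : Ω → ℝ) ω := by
      rw [← h5]
      rw [Nat.card_Icc] at h4
      exact_mod_cast h4
    have h10 := Nat.cast_le (α := ℝ).mpr h1
    rw [Nat.cast_add] at h10
    refine (h10.trans (add_le_add h9 h8)).trans (le_of_eq ?_)
    rw [hρ]
    simp only [logResidual]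
    have h11 : ∀ n, Set.indicator {z | μ a + ε < z} (1 : ℝ → ℝ)
        (sampleMean (fun i => X a i ω) n) = (E n).indicator (1 : Ω → ℝ) ω := fun n => by
      simp [Set.indicator_apply, hE]
    have h12 : Set.indicator {y | SourceExceeds (μ' a + ε) y (N' a)} (1 : (ℕ → ℝ) → ℝ)
        (fun i => Y a i ω) = F.indicator (1 : Ω → ℝ) ω := by
      simp [Set.indicator_apply, hF]
    rw [h12, Finset.sum_congr rfl fun n _ => h11 n]
    ring
  have hi1 : ∀ S : Set Ω, MeasurableSet S → Integrable (S.indicator (1 : Ω → ℝ)) P :=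
    fun S hS => (integrable_const (1 : ℝ)).indicator hS
  have hiB : Integrable (fun ω => ∑ t ∈ Finset.Icc 8 T, (B t).indicator (1 : Ω → ℝ) ω) P :=
    integrable_finsetSum _ fun t _ => hi1 _ (hBm t)
  have hiE : Integrable (fun ω => ∑ n ∈ Finset.range T, (E n).indicator (1 : Ω → ℝ) ω) P :=
    integrable_finsetSum _ fun n _ => hi1 _ (hEm n)
  have hi8B : Integrable
      (fun ω => 8 + ∑ t ∈ Finset.Icc 8 T, (B t).indicator (1 : Ω → ℝ) ω) P :=
    (integrable_const _).add hiB
  have hiF : Integrable (fun ω => ρ + D * F.indicator (1 : Ω → ℝ) ω) P :=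
    (integrable_const _).add ((hi1 F hFm).const_mul D)
  have hBsum : ∑ t ∈ Finset.Icc 8 T, P.real (B t) ≤ 12 * (1 + 4 * σ ^ 2 / ε ^ 2) := by
    calc ∑ t ∈ Finset.Icc 8 T, P.real (B t)
        ≤ ∑ t ∈ Finset.Icc 8 T,
            12 * (1 / ((t : ℝ) * Real.log t ^ 2)) * (1 + 4 * σ ^ 2 / ε ^ 2) := by
          refine Finset.sum_le_sum fun t ht => ?_
          have ht8 := (Finset.mem_Icc.mp ht).1
          refine (hM.real_deviationEvent_le hσ hσ' best (N' best) hε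
            (two_le_explorationLevel ht8) t).trans ?_
          exact mul_le_mul_of_nonneg_right (explorationLevel_mul_exp_le ht8) (by positivity)
      _ = 12 * (1 + 4 * σ ^ 2 / ε ^ 2) *
            ∑ t ∈ Finset.Icc 8 T, 1 / ((t : ℝ) * Real.log t ^ 2) := by
          rw [Finset.mul_sum]
          exact Finset.sum_congr rfl fun t _ => by ring
      _ ≤ 12 * (1 + 4 * σ ^ 2 / ε ^ 2) * 1 :=
          mul_le_mul_of_nonneg_left (sum_one_div_mul_log_sq_le T) (by positivity)
      _ = _ := mul_one _
  have hEsum : ∑ n ∈ Finset.range T, P.real (E n) ≤ 2 * (1 + 4 * σ ^ 2 / ε ^ 2) := by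
    refine (Finset.sum_le_sum fun n _ => real_sampleMean_tail_le (hM.measurable_target a)
      (hM.iIndepFun_target a) hσ (hM.law_target a) hε n).trans ?_
    rw [← Finset.mul_sum]
    refine mul_le_mul_of_nonneg_left
      ((sum_exp_neg_le (by positivity : 0 < ε ^ 2 / (4 * σ ^ 2)) T).trans_eq ?_) (by norm_num)
    rw [one_div_div]
  have hFle : D * P.real F ≤ 4 * b ^ 2 / ε ^ 2 := hM.mul_real_sourceExceeds_le hσ' a (N' a) b hε
  have hint : ∫ ω, (pulls (fun s => A s ω) a T : ℝ) ∂P ≤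
      8 + ∑ t ∈ Finset.Icc 8 T, P.real (B t) + ∑ n ∈ Finset.range T, P.real (E n)
        + κ * (ρ + D * P.real F) := by
    refine (integral_mono_of_nonneg (ae_of_all _ fun ω => Nat.cast_nonneg _)
      ((hi8B.add hiE).add (hiF.const_mul κ)) hpath).trans_eq ?_
    rw [integral_add' (hi8B.add hiE) (hiF.const_mul κ), integral_add' hi8B hiE,
      integral_add (integrable_const _) hiB,
      integral_finsetSum _ fun t _ => hi1 _ (hBm t), integral_finsetSum _ fun n _ => hi1 _ (hEm n),
      integral_const_mul, integral_add (integrable_const _) ((hi1 F hFm).const_mul D),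
      integral_const_mul, integral_indicator_one hFm]
    simp only [integral_indicator_one, hBm, hEm, integral_const, probReal_univ, one_smul]
  have hκF := mul_le_mul_of_nonneg_left (add_le_add_right hFle ρ) hκ0
  linarith

end Model

/-- The deterministic bound with the resolution `ε = (ln T)^(-1/3)`. -/
theorem fixed_resolution_bound_le {σ Δ b ε l w r x : ℝ} (hσ : 0 < σ) (hΔ : 0 < Δ) (hb : 0 ≤ b)
    (hε : 0 < ε) (hεΔ : 12 * ε ≤ Δ) (hw : 1 ≤ w) (hεl : ε * l = w) (hεw : 1 / ε ^ 2 = w)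
    (hr0 : 0 ≤ r) (hrl : r ≤ l) (hx0 : 0 ≤ x) (hx : x ≤ 9 / 2 * w) :
    8 + 14 * (1 + 4 * σ ^ 2 / ε ^ 2)
        + 2 * σ ^ 2 / (Δ - 3 * ε) ^ 2 * (r + x + 12 / b * ε * l + 4 * b ^ 2 / ε ^ 2) ≤
      2 * σ ^ 2 / Δ ^ 2 * r +
        (22 + 56 * σ ^ 2
          + 2 * σ ^ 2 / Δ ^ 2 * (12 / Δ + 2 * (9 / 2 + 12 / b + 4 * b ^ 2))) * w := by
  set v := ε / Δ with hv
  have hεv : ε = v * Δ := by rw [hv]; field_simp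
  have hv0 : 0 < v := by positivity
  have hv1 : v ≤ 1 / 12 := by rw [hv, div_le_iff₀ hΔ]; linarith
  -- For `v ≤ 1/12`, `(1 + 12v)(1 - 3v)² - 1 = v (6 - 63v + 108v²) ≥ 0`.
  have h1 : 2 * σ ^ 2 / (Δ - 3 * ε) ^ 2 ≤ 2 * σ ^ 2 / Δ ^ 2 * (1 + 12 * v) := by
    have hpos : 0 < 1 - 3 * v := by linarith
    rw [show Δ - 3 * ε = Δ * (1 - 3 * v) by rw [hεv]; ring, mul_pow, ← div_div,
      div_le_iff₀ (by positivity), mul_assoc]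
    refine le_mul_of_one_le_right (by positivity) ?_
    nlinarith [mul_nonneg hv0.le (by nlinarith : 0 ≤ 6 - 63 * v + 108 * v ^ 2)]
  have h2 : 12 / b * ε * l = 12 / b * w := by rw [mul_assoc, hεl]
  have h3 : ∀ z : ℝ, z / ε ^ 2 = z * w := fun z => by rw [← hεw]; ring
  rw [h2, h3, h3]
  have hw0 : 0 < w := by linarith
  have hg0 : 0 ≤ x + 12 / b * w + 4 * b ^ 2 * w := by positivity
  have hg : x + 12 / b * w + 4 * b ^ 2 * w ≤ (9 / 2 + 12 / b + 4 * b ^ 2) * w := by linarith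
  have h4 : 12 * v * r ≤ 12 / Δ * w := by
    rw [← hεl, show 12 / Δ * (ε * l) = 12 * v * l by rw [hv]; ring]
    gcongr
  have h5 : (1 + 12 * v) * (r + (x + 12 / b * w + 4 * b ^ 2 * w)) ≤
      r + (12 / Δ + 2 * (9 / 2 + 12 / b + 4 * b ^ 2)) * w := by
    have : (1 + 12 * v) * (x + 12 / b * w + 4 * b ^ 2 * w) ≤
        2 * ((9 / 2 + 12 / b + 4 * b ^ 2) * w) :=
      mul_le_mul (by linarith) hg hg0 (by norm_num)
    linarith
  have hc : 0 ≤ 2 * σ ^ 2 / Δ ^ 2 := by positivity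
  have h6 := mul_le_mul_of_nonneg_right h1 (add_nonneg hr0 hg0)
  have h7 := mul_le_mul_of_nonneg_left h5 hc
  linarith

theorem logResidual_nonneg (σ' : ℝ) (n' : ℕ∞) (c m : ℝ) (T : ℕ) :
    0 ≤ logResidual σ' n' c m T := ENNReal.toReal_nonneg

theorem logResidual_le_log (σ' : ℝ) (n' : ℕ∞) (c m : ℝ) (T : ℕ) :
    logResidual σ' n' c m T ≤ Real.log T :=
  ENNReal.toReal_le_of_le_ofReal (Real.log_natCast_nonneg T) tsub_le_self

end KLUCBTransfer

/-! ### Choice of the resolution and conclusion -/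

theorem theorem2 {K : ℕ} (μ μ' L : Fin K → ℝ) (σ σ' : ℝ) (hσ : 0 < σ) (hσ' : 0 < σ')
    (hL : ∀ k, |μ k - μ' k| ≤ L k)
    (best : Fin K) (hbest : ∀ k, μ k ≤ μ best)
    (a : Fin K) (ha : μ a < μ best) :
    ∃ C : ℝ, ∀ (N' : Fin K → ℕ∞) {Ω : Type u} [MeasurableSpace Ω] (P : Measure Ω)
      [IsProbabilityMeasure P] (X Y : Fin K → ℕ → Ω → ℝ) (A : ℕ → Ω → Fin K),
      KLUCBTransfer.IsGaussianTransferModel P μ μ' σ σ' X Y →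
      KLUCBTransfer.IsPolicyRun σ σ' L N' X Y A →
      ∀ T : ℕ, 2 ≤ T →
        ∫ ω, (KLUCBTransfer.pulls (fun s => A s ω) a T : ℝ) ∂P ≤
          2 * σ ^ 2 / (μ best - μ a) ^ 2 *
              KLUCBTransfer.logResidual σ' (N' a) (μ' a + L a) (μ best) T
            + C * (Real.log T) ^ (2 / 3 : ℝ) := by
  obtain ⟨b, hb⟩ : ∃ b, b = max (μ best - μ' a - L a) 0 := ⟨_, rfl⟩
  have hb0 : 0 ≤ b := hb ▸ le_max_right _ _
  have hΔ : 0 < μ best - μ a := sub_pos.mpr ha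
  obtain ⟨η, hη, hηΔ, hηb⟩ : ∃ η : ℝ, 0 < η ∧ 12 * η ≤ μ best - μ a ∧ (b = 0 ∨ 12 * η ≤ b) := by
    rcases hb0.eq_or_lt with h | h
    · exact ⟨(μ best - μ a) / 12, by positivity, by linarith, Or.inl h.symm⟩
    · refine ⟨min (μ best - μ a) b / 12, by positivity, ?_, Or.inr ?_⟩
      · linarith [min_le_left (μ best - μ a) b]
      · linarith [min_le_right (μ best - μ a) b]
  have hlog : Tendsto (fun T : ℕ => Real.log T) atTop atTop :=
    Real.tendsto_log_atTop.comp tendsto_natCast_atTop_atTop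
  have hev : ∀ᶠ T : ℕ in atTop, (Real.log T) ^ (-(1 / 3) : ℝ) < η :=
    ((tendsto_rpow_neg_atTop (by norm_num : (0 : ℝ) < 1 / 3)).comp hlog).eventually_lt_const hη
  obtain ⟨T₀, hT₀⟩ := eventually_atTop.mp hev
  set C₁ := 22 + 56 * σ ^ 2 + 2 * σ ^ 2 / (μ best - μ a) ^ 2 *
    (12 / (μ best - μ a) + 2 * (9 / 2 + 12 / b + 4 * b ^ 2)) with hC₁
  have hC₁0 : 0 ≤ C₁ := by positivity
  -- Pays for the trivial bound `T` on the finitely many horizons where `(ln T)^(-1/3)` may still be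
  -- too coarse or `T < 8`.
  set C₂ := ((max T₀ 8 : ℕ) : ℝ) / (Real.log 2) ^ (2 / 3 : ℝ) with hC₂
  have hlog2 : 0 < Real.log 2 := Real.log_pos (by norm_num)
  have hC₂0 : 0 ≤ C₂ := by positivity
  refine ⟨C₁ + C₂, ?_⟩
  intro N' Ω _ P _ X Y A hM hA T hT
  have hl2 : Real.log 2 ≤ Real.log T := Real.log_le_log (by norm_num) (by exact_mod_cast hT)
  have hl0 : 0 < Real.log T := hlog2.trans_le hl2
  have hr0 := KLUCBTransfer.logResidual_nonneg σ' (N' a) (μ' a + L a) (μ best) T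
  have hw0 : 0 ≤ (Real.log T) ^ (2 / 3 : ℝ) := by positivity
  rcases lt_or_ge T (max T₀ 8) with hsmall | hlarge
  · have h1 : ∫ ω, (KLUCBTransfer.pulls (fun s => A s ω) a T : ℝ) ∂P ≤ T := by
      refine (integral_mono_of_nonneg (ae_of_all _ fun ω => Nat.cast_nonneg _)
        (integrable_const (T : ℝ))
        (ae_of_all _ fun ω => Nat.cast_le.mpr (KLUCBTransfer.pulls_le _ a T))).trans_eq ?_
      simp
    have h2 : (T : ℝ) ≤ C₂ * (Real.log T) ^ (2 / 3 : ℝ) := by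
      have h3 : (Real.log 2) ^ (2 / 3 : ℝ) ≤ (Real.log T) ^ (2 / 3 : ℝ) :=
        Real.rpow_le_rpow hlog2.le hl2 (by norm_num)
      have h4 : (T : ℝ) ≤ (max T₀ 8 : ℕ) := by exact_mod_cast hsmall.le
      refine h4.trans ?_
      rw [hC₂, div_mul_eq_mul_div, le_div_iff₀ (by positivity)]
      gcongr
    have h5 := mul_nonneg hC₁0 hw0
    have h6 : 0 ≤ 2 * σ ^ 2 / (μ best - μ a) ^ 2 *
        KLUCBTransfer.logResidual σ' (N' a) (μ' a + L a) (μ best) T := by positivity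
    linarith
  · have hT8 : 8 ≤ T := (le_max_right _ _).trans hlarge
    have hε := hT₀ T ((le_max_left _ _).trans hlarge)
    have hε0 : 0 < (Real.log T) ^ (-(1 / 3) : ℝ) := by positivity
    have hl1 : 1 ≤ Real.log T := by
      rw [Real.le_log_iff_exp_le (by positivity)]
      have : (8 : ℝ) ≤ T := by exact_mod_cast hT8
      linarith [Real.exp_one_lt_three]
    have hb12 : b = 0 ∨ 12 * (Real.log T) ^ (-(1 / 3) : ℝ) ≤ b :=
      hηb.imp_right fun h => by linarith
    have h1 := KLUCBTransfer.expected_pulls_le hσ hσ' hL hM hA (a := a) (best := best) hε0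
      (by linarith) hb hb12 T
    have h2 := KLUCBTransfer.fixed_resolution_bound_le (σ := σ) (Δ := μ best - μ a) (b := b)
      (ε := (Real.log T) ^ (-(1 / 3) : ℝ)) (l := Real.log T) (w := (Real.log T) ^ (2 / 3 : ℝ))
      (r := KLUCBTransfer.logResidual σ' (N' a) (μ' a + L a) (μ best) T)
      (x := KLUCBTransfer.explorationLevel T - Real.log T) hσ hΔ hb0 hε0 (by linarith)
      (Real.one_le_rpow hl1 (by norm_num))
      (by rw [← Real.rpow_add_one hl0.ne']; norm_num)
      (by
        rw [one_div, ← Real.rpow_natCast, ← Real.rpow_mul hl0.le, ← Real.rpow_neg hl0.le]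
        norm_num)
      hr0 (KLUCBTransfer.logResidual_le_log _ _ _ _ _)
      (by
        rw [KLUCBTransfer.explorationLevel, max_eq_right hl1]
        linarith [Real.log_nonneg hl1])
      -- `δ_T - ln T = 3 ln (ln T)`, and `ln z ≤ (3/2) z^(2/3)` gives the constant `9/2`.
      (by
        rw [KLUCBTransfer.explorationLevel, max_eq_right hl1]
        linarith [Real.log_le_rpow_div hl0.le (by norm_num : (0 : ℝ) < 2 / 3)])
    have h3 := mul_nonneg hC₂0 hw0
    rw [← hC₁] at h2
    linarith
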